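/- Theorem 1.19 (density theorem). Let $(X_0,X_1)$ be a compatible couple of (real or complex) Banach spaces, i.e. $X_0$ and $X_1$ are continuously embedded in a common Hausdorff topological vector space; equip $X_0\cap X_1$ with the norm $\max\{\|f\|_{X_0},\|f\|_{X_1}\}$ and $X_0+X_1$ with the norm $\inf\{\|f_0\|_{X_0}+\|f_1\|_{X_1}: f=f_0+f_1,\ f_0\in X_0,\ f_1\in X_1\}$. Let $a:(0,\infty)\to(0,\infty)$ be (i) slowly varying: $a$ is Lebesgue-measurable and, for every $\varepsilon>0$, $t^{\varepsilon}a(t)$ is equivalent on $(0,\infty)$ to a non-decreasing function and $t^{-\varepsilon}a(t)$ is equivalent on $(0,\infty)$ to a non-increasing function (two non-negative functions $g,h$ are equivalent if $c_1h\le g\le c_2h$ for some constants $c_1,c_2>0$); (ii) absolutely continuous on every compact subinterval of $(0,\infty)$; (iii) strictly decreasing, with $\lim_{t\to0+}a(t)=\infty$ and $\lim_{t\to\infty}a(t)>0$. Let $(X_0,X_1)_{0,1,a;J}$ be the space of all $f\in X_0+X_1$ with $\|f\|_{0,1,a;J}<\infty$, where $$\|f\|_{0,1,a;J}:=\inf_u\int_0^\infty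 t^{-1}a(t)\,\max\{\|u(t)\|_{X_0},\,t\,\|u(t)\|_{X_1}\}\,dt ,$$ the infimum being taken over all strongly measurable functions $u:(0,\infty)\to X_0\cap X_1$ such that $f=\int_0^\infty u(s)\,\frac{ds}{s}$ with convergence in $X_0+X_1$ (as a Bochner integral), and $\inf\emptyset=\infty$. Then $X_0\cap X_1$ is dense in $(X_0,X_1)_{0,1,a;J}$. That is, $X_0\cap X_1\subset (X_0,X_1)_{0,1,a;J}$, and for every $f\in(X_0,X_1)_{0,1,a;J}$ and every $\varepsilon>0$ there is $g\in X_0\cap X_1$ with $\|f-g\|_{0,1,a;J}<\varepsilon$. -/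

import Mathlib

open Set Filter Topology MeasureTheory
open scoped ENNReal

noncomputable section

/-- A compatible couple `(X₀, X₁)` of Banach spaces: both spaces are continuously embedded in the
Hausdorff topological vector space `E` (by the injective continuous linear maps `ι₀`, `ι₁`). -/
structure CompatibleCouple (𝕜 : Type*) [RCLike 𝕜]
    (X₀ : Type*) [NormedAddCommGroup X₀] [NormedSpace 𝕜 X₀] [CompleteSpace X₀]
    (X₁ : Type*) [NormedAddCommGroup X₁] [NormedSpace 𝕜 X₁] [CompleteSpace X₁]
    (E : Type*) [AddCommGroup E] [Module 𝕜 E] [TopologicalSpace E]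
    [IsTopologicalAddGroup E] [ContinuousSMul 𝕜 E] [T2Space E] where
  ι₀ : X₀ →L[𝕜] E
  ι₁ : X₁ →L[𝕜] E
  injective_ι₀ : Function.Injective ι₀
  injective_ι₁ : Function.Injective ι₁

namespace CompatibleCouple

variable {𝕜 : Type*} [RCLike 𝕜]
  {X₀ : Type*} [NormedAddCommGroup X₀] [NormedSpace 𝕜 X₀] [CompleteSpace X₀]
  {X₁ : Type*} [NormedAddCommGroup X₁] [NormedSpace 𝕜 X₁] [CompleteSpace X₁]
  {E : Type*} [AddCommGroup E] [Module 𝕜 E] [TopologicalSpace E]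
  [IsTopologicalAddGroup E] [ContinuousSMul 𝕜 E] [T2Space E]
  (C : CompatibleCouple 𝕜 X₀ X₁ E)

/-- The intersection `X₀ ∩ X₁`. An element is given by its two incarnations `x₀ ∈ X₀` and
`x₁ ∈ X₁`, which are the same vector of `E`. The norm inherited from `X₀ × X₁` is
`max ‖f‖_{X₀} ‖f‖_{X₁}`. -/
def inter : Submodule 𝕜 (X₀ × X₁) :=
  LinearMap.eqLocus ((C.ι₀ : X₀ →ₗ[𝕜] E) ∘ₗ LinearMap.fst 𝕜 X₀ X₁)
    ((C.ι₁ : X₁ →ₗ[𝕜] E) ∘ₗ LinearMap.snd 𝕜 X₀ X₁)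

/-- The Peetre `J`-functional `J(f, t; X₀, X₁) = max {‖f‖_{X₀}, t ‖f‖_{X₁}}`. -/
def J (f : C.inter) (t : ℝ) : ℝ := max ‖f.1.1‖ (t * ‖f.1.2‖)

/-- The Peetre `K`-functional `K(f, t; X₀, X₁)`. -/
def K (f : E) (t : ℝ) : ℝ :=
  sInf {r : ℝ | ∃ (x₀ : X₀) (x₁ : X₁), f = C.ι₀ x₀ + C.ι₁ x₁ ∧ r = ‖x₀‖ + t * ‖x₁‖}

/-- The sum `X₀ + X₁ ⊆ E`, as a type of its own because it carries the norm `K(f, 1; X₀, X₁)`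
and not the topology of `E`. -/
def Sum : Type _ :=
  ↥(LinearMap.range (C.ι₀ : X₀ →ₗ[𝕜] E) ⊔ LinearMap.range (C.ι₁ : X₁ →ₗ[𝕜] E))

instance : AddCommGroup C.Sum :=
  inferInstanceAs (AddCommGroup
    ↥(LinearMap.range (C.ι₀ : X₀ →ₗ[𝕜] E) ⊔ LinearMap.range (C.ι₁ : X₁ →ₗ[𝕜] E)))

instance : Module 𝕜 C.Sum :=
  inferInstanceAs (Module 𝕜
    ↥(LinearMap.range (C.ι₀ : X₀ →ₗ[𝕜] E) ⊔ LinearMap.range (C.ι₁ : X₁ →ₗ[𝕜] E)))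

/-- The inclusion of `X₀ + X₁` in `E`. -/
def sumVal : C.Sum →ₗ[𝕜] E :=
  (LinearMap.range (C.ι₀ : X₀ →ₗ[𝕜] E) ⊔ LinearMap.range (C.ι₁ : X₁ →ₗ[𝕜] E)).subtype

theorem sumVal_injective : Function.Injective C.sumVal := Subtype.val_injective

instance : Norm C.Sum := ⟨fun f => C.K (C.sumVal f) 1⟩

theorem norm_sum_def (f : C.Sum) : ‖f‖ = C.K (C.sumVal f) 1 := rfl

/-- The element `x₀ + x₁` of `X₀ + X₁`. -/
def mkSum : (X₀ × X₁) →ₗ[𝕜] C.Sum :=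
  LinearMap.codRestrict
    (LinearMap.range (C.ι₀ : X₀ →ₗ[𝕜] E) ⊔ LinearMap.range (C.ι₁ : X₁ →ₗ[𝕜] E))
    (LinearMap.coprod (C.ι₀ : X₀ →ₗ[𝕜] E) (C.ι₁ : X₁ →ₗ[𝕜] E))
    (fun x => Submodule.add_mem_sup ⟨x.1, rfl⟩ ⟨x.2, rfl⟩)

theorem sumVal_mkSum (x : X₀ × X₁) : C.sumVal (C.mkSum x) = C.ι₀ x.1 + C.ι₁ x.2 := rfl

theorem mkSum_surjective : Function.Surjective C.mkSum := by
  rintro ⟨f, hf⟩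
  obtain ⟨_, ⟨x₀, rfl⟩, _, ⟨x₁, rfl⟩, rfl⟩ := Submodule.mem_sup.1 hf
  exact ⟨(x₀, x₁), rfl⟩

theorem norm_mkSum_le (x : X₀ × X₁) : ‖C.mkSum x‖ ≤ ‖x.1‖ + ‖x.2‖ := by
  refine csInf_le ⟨0, ?_⟩ ⟨x.1, x.2, C.sumVal_mkSum x, by ring⟩
  rintro r ⟨x₀, x₁, -, rfl⟩
  positivity

theorem exists_mkSum (f : C.Sum) {ε : ℝ} (hε : 0 < ε) :
    ∃ x : X₀ × X₁, C.mkSum x = f ∧ ‖x.1‖ + ‖x.2‖ < ‖f‖ + ε := by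
  obtain ⟨y, hy⟩ := C.mkSum_surjective f
  have hne : {r : ℝ | ∃ (x₀ : X₀) (x₁ : X₁),
      C.sumVal f = C.ι₀ x₀ + C.ι₁ x₁ ∧ r = ‖x₀‖ + 1 * ‖x₁‖}.Nonempty :=
    ⟨_, y.1, y.2, by rw [← hy, sumVal_mkSum], rfl⟩
  obtain ⟨r, ⟨x₀, x₁, h, rfl⟩, hr⟩ := Real.lt_sInf_add_pos hne hε
  refine ⟨(x₀, x₁), C.sumVal_injective ?_, ?_⟩
  · rw [sumVal_mkSum, h]
  · rw [one_mul] at hr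
    exact hr

theorem norm_sum_nonneg (f : C.Sum) : 0 ≤ ‖f‖ := by
  apply Real.sInf_nonneg
  rintro r ⟨x₀, x₁, -, rfl⟩
  positivity

theorem norm_sum_smul_le (c : 𝕜) (f : C.Sum) : ‖c • f‖ ≤ ‖c‖ * ‖f‖ := by
  refine le_of_forall_pos_le_add fun ε hε => ?_
  have hc : 0 < ‖c‖ + 1 := by positivity
  obtain ⟨x, rfl, hx⟩ := C.exists_mkSum f (div_pos hε hc)
  rw [← map_smul]
  refine (C.norm_mkSum_le _).trans ?_
  simp only [Prod.smul_fst, Prod.smul_snd, norm_smul]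
  have h1 : ‖c‖ * (ε / (‖c‖ + 1)) ≤ ε := by
    rw [mul_div_assoc', div_le_iff₀ hc]
    nlinarith
  nlinarith [mul_le_mul_of_nonneg_left hx.le (norm_nonneg c)]

theorem normedSpaceCore : NormedSpace.Core 𝕜 C.Sum where
  norm_nonneg := C.norm_sum_nonneg
  norm_smul c f := by
    refine le_antisymm (C.norm_sum_smul_le c f) ?_
    by_cases hc : c = 0
    · subst hc
      simpa using C.norm_sum_nonneg ((0 : 𝕜) • f)
    · have h := C.norm_sum_smul_le c⁻¹ (c • f)
      rw [inv_smul_smul₀ hc, norm_inv] at h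
      have hc' : 0 < ‖c‖ := norm_pos_iff.2 hc
      calc ‖c‖ * ‖f‖ ≤ ‖c‖ * (‖c‖⁻¹ * ‖c • f‖) := by gcongr
        _ = ‖c • f‖ := by field_simp
  norm_triangle f g := by
    refine le_of_forall_pos_le_add fun ε hε => ?_
    obtain ⟨x, rfl, hx⟩ := C.exists_mkSum f (half_pos hε)
    obtain ⟨y, rfl, hy⟩ := C.exists_mkSum g (half_pos hε)
    rw [← map_add]
    refine (C.norm_mkSum_le _).trans ?_
    have h0 := norm_add_le x.1 y.1
    have h1 := norm_add_le x.2 y.2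
    simp only [Prod.fst_add, Prod.snd_add]
    linarith
  norm_eq_zero_iff f := by
    constructor
    · intro hf
      have H : ∀ n : ℕ, ∃ x : X₀ × X₁, C.mkSum x = f ∧ ‖x.1‖ + ‖x.2‖ < 1 / ((n : ℝ) + 1) := by
        intro n
        obtain ⟨x, hx, hx'⟩ := C.exists_mkSum f (ε := 1 / ((n : ℝ) + 1)) (by positivity)
        exact ⟨x, hx, by simpa [hf] using hx'⟩
      choose x hx hx' using H
      have h0 : Tendsto (fun n => (x n).1) atTop (𝓝 0) :=
        squeeze_zero_norm (fun n => (by have := norm_nonneg (x n).2; linarith [hx' n]))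
          tendsto_one_div_add_atTop_nhds_zero_nat
      have h1 : Tendsto (fun n => (x n).2) atTop (𝓝 0) :=
        squeeze_zero_norm (fun n => (by have := norm_nonneg (x n).1; linarith [hx' n]))
          tendsto_one_div_add_atTop_nhds_zero_nat
      have h2 := ((C.ι₀.continuous.tendsto 0).comp h0).add ((C.ι₁.continuous.tendsto 0).comp h1)
      have h3 : (fun n => (C.ι₀ ∘ fun n => (x n).1) n + (C.ι₁ ∘ fun n => (x n).2) n)
          = fun _ => C.sumVal f := by
        funext n
        rw [← hx n, sumVal_mkSum]
        rfl
      rw [h3, map_zero, map_zero, add_zero] at h2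
      apply C.sumVal_injective
      rw [map_zero]
      exact tendsto_nhds_unique tendsto_const_nhds h2
    · rintro rfl
      refine le_antisymm ?_ (C.norm_sum_nonneg 0)
      simpa using C.norm_mkSum_le 0

instance : NormedAddCommGroup C.Sum := NormedAddCommGroup.ofCore C.normedSpaceCore

instance : NormedSpace 𝕜 C.Sum := NormedSpace.ofCore C.normedSpaceCore

instance : NormedSpace ℝ C.Sum := NormedSpace.restrictScalars ℝ 𝕜 C.Sum

/-- `X₀ + X₁` is a Banach space, so that Bochner integrals with values in it make sense. -/
instance : CompleteSpace C.Sum := by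
  refine NormedAddCommGroup.completeSpace_of_summable_imp_tendsto fun u hu => ?_
  have H : ∀ n : ℕ, ∃ x : X₀ × X₁, C.mkSum x = u n ∧
      ‖x.1‖ + ‖x.2‖ < ‖u n‖ + (1 / 2 : ℝ) ^ n := fun n => C.exists_mkSum (u n) (by positivity)
  choose x hx hx' using H
  have hs : Summable fun n => ‖u n‖ + (1 / 2 : ℝ) ^ n := hu.add summable_geometric_two
  have h0 : Summable fun n => (x n).1 := Summable.of_norm_bounded hs
    fun n => by have := norm_nonneg (x n).2; linarith [hx' n]
  have h1 : Summable fun n => (x n).2 := Summable.of_norm_bounded hs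
    fun n => by have := norm_nonneg (x n).1; linarith [hx' n]
  refine ⟨C.mkSum (∑' n, (x n).1, ∑' n, (x n).2), ?_⟩
  rw [tendsto_iff_norm_sub_tendsto_zero]
  have t0 := (tendsto_iff_norm_sub_tendsto_zero.1 h0.hasSum.tendsto_sum_nat)
  have t1 := (tendsto_iff_norm_sub_tendsto_zero.1 h1.hasSum.tendsto_sum_nat)
  refine squeeze_zero (fun n => norm_nonneg _) (fun n => ?_) (by simpa using t0.add t1)
  have : ∑ i ∈ Finset.range n, u i = C.mkSum (∑ i ∈ Finset.range n, x i) := by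
    rw [map_sum]
    exact Finset.sum_congr rfl fun i _ => (hx i).symm
  rw [this, ← map_sub]
  refine (C.norm_mkSum_le _).trans (le_of_eq ?_)
  simp [Prod.fst_sum, Prod.snd_sum]

/-- The inclusion `X₀ ∩ X₁ ⊆ X₀ + X₁`; as a vector of `E`, the image of `f` is `f` itself. -/
def interToSum : C.inter →ₗ[𝕜] C.Sum :=
  C.mkSum ∘ₗ LinearMap.inl 𝕜 X₀ X₁ ∘ₗ LinearMap.fst 𝕜 X₀ X₁ ∘ₗ C.inter.subtype

/-- `f = ∫₀^∞ u(s) ds/s` with a strongly measurable `u : (0, ∞) → X₀ ∩ X₁` and an integral that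
converges in `X₀ + X₁` (as a Bochner integral). -/
structure IsJRepresentation (u : ℝ → C.inter) (f : C.Sum) : Prop where
  aestronglyMeasurable : AEStronglyMeasurable u (volume.restrict (Ioi 0))
  integrableOn : IntegrableOn (fun s : ℝ => s⁻¹ • C.interToSum (u s)) (Ioi 0)
  integral_eq : ∫ s in Ioi (0 : ℝ), s⁻¹ • C.interToSum (u s) = f

/-- The functional `‖f‖_{θ,q,v;J} = inf ‖t^{-θ-1/q} v(t) J(u(t), t; X₀, X₁)‖_{q,(0,∞)}`, the infimum
over all representations `f = ∫₀^∞ u(s) ds/s`; it is `∞` if there is none. For `q = ∞` the value of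
`1 / q.toReal` is `0`, as it should be. -/
def jNorm (θ : ℝ) (q : ℝ≥0∞) (v : ℝ → ℝ) (f : C.Sum) : ℝ≥0∞ :=
  ⨅ (u : ℝ → C.inter) (_ : C.IsJRepresentation u f),
    eLpNorm (fun t : ℝ => t ^ (-θ - 1 / q.toReal) * v t * C.J (u t) t) q (volume.restrict (Ioi 0))

/-- The space `(X₀, X₁)_{θ,q,v;J}`. -/
def jSpace (θ : ℝ) (q : ℝ≥0∞) (v : ℝ → ℝ) : Set C.Sum :=
  {f | C.jNorm θ q v f < ∞}

end CompatibleCouple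

/-- The two functions are equivalent on `(0, ∞)`: each is at most a constant multiple of the
other one. -/
def EquivalentOnPos (f g : ℝ → ℝ) : Prop :=
  ∃ c₁ c₂ : ℝ, 0 < c₁ ∧ 0 < c₂ ∧ ∀ t : ℝ, 0 < t → c₁ * g t ≤ f t ∧ f t ≤ c₂ * g t

/-- The class `SV(0, ∞)` of slowly varying functions. -/
structure SlowlyVarying (b : ℝ → ℝ) : Prop where
  pos : ∀ t : ℝ, 0 < t → 0 < b t
  aemeasurable : AEMeasurable b (volume.restrict (Ioi 0))
  equiv_monotone : ∀ ε : ℝ, 0 < ε → ∃ g : ℝ → ℝ,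
    MonotoneOn g (Ioi 0) ∧ EquivalentOnPos (fun t : ℝ => t ^ ε * b t) g
  equiv_antitone : ∀ ε : ℝ, 0 < ε → ∃ g : ℝ → ℝ,
    AntitoneOn g (Ioi 0) ∧ EquivalentOnPos (fun t : ℝ => t ^ (-ε) * b t) g

/-- The class `AC(0, ∞)`: absolute continuity on every compact subinterval of `(0, ∞)`. -/
def AbsContOnPos (b : ℝ → ℝ) : Prop :=
  ∀ x y : ℝ, 0 < x → x ≤ y → AbsolutelyContinuousOnInterval b x y

end

/-! Take a representation `u` of `f` with finite weighted integral and keep only its part over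
`[1/M, M]`. There `J(·, t)` dominates a fixed multiple of the norm of `X₀ ∩ X₁`, and `a`, being
decreasing, stays above its positive limit at infinity. Hence `u(s)/s` is Bochner integrable over
`[1/M, M]` with values in `X₀ ∩ X₁` (`integrableOn_of_jIntegrand`), and its integral is the
approximant `g`. The discarded part of `u` represents `f - g` (`IsJRepresentation.sub_integral`), so
the error is at most the tail of a convergent integral (`exists_eLpNorm_indicator_compl_Icc_lt`). -/

namespace CompatibleCouple

variable {𝕜 : Type*} [RCLike 𝕜]
  {X₀ : Type*} [NormedAddCommGroup X₀] [NormedSpace 𝕜 X₀] [CompleteSpace X₀]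
  {X₁ : Type*} [NormedAddCommGroup X₁] [NormedSpace 𝕜 X₁] [CompleteSpace X₁]
  {E : Type*} [AddCommGroup E] [Module 𝕜 E] [TopologicalSpace E]
  [IsTopologicalAddGroup E] [ContinuousSMul 𝕜 E] [T2Space E]
  (C : CompatibleCouple 𝕜 X₀ X₁ E)

/-! ### The intersection as a real Banach space, and `J` against its norm. -/

noncomputable instance : NormedSpace ℝ C.inter := NormedSpace.restrictScalars ℝ 𝕜 C.inter

/-- Closedness in `X₀ × X₁` comes from `E` being Hausdorff. Completeness matters because the Bochner
integral has the default value `0` in an incomplete space. -/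
instance : CompleteSpace C.inter := by
  have h : IsClosed (C.inter : Set (X₀ × X₁)) :=
    isClosed_eq (C.ι₀.continuous.comp continuous_fst) (C.ι₁.continuous.comp continuous_snd)
  exact h.completeSpace_coe

theorem norm_interToSum_le (g : C.inter) : ‖C.interToSum g‖ ≤ 1 * ‖g‖ := by
  have h := C.norm_mkSum_le (g.1.1, 0)
  rw [norm_zero, add_zero] at h
  rw [one_mul]
  exact h.trans (le_max_left _ _)

/-- The inclusion `X₀ ∩ X₁ ⊆ X₀ + X₁` as a continuous real-linear map. -/
noncomputable def interToSumCLM : C.inter →L[ℝ] C.Sum :=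
  LinearMap.mkContinuous
    { toFun := C.interToSum
      map_add' := map_add C.interToSum
      map_smul' := fun c x => C.interToSum.map_smul (c : 𝕜) x } 1 C.norm_interToSum_le

theorem interToSumCLM_apply (g : C.inter) : C.interToSumCLM g = C.interToSum g := rfl

theorem J_zero (t : ℝ) : C.J 0 t = 0 := by simp [J]

theorem J_nonneg (g : C.inter) (t : ℝ) : 0 ≤ C.J g t := (norm_nonneg _).trans (le_max_left _ _)

/-- Only a lower bound on `t` matters: the factor `t` weakens the `X₁` part of `J` when `t` is
small. -/
theorem norm_le_mul_J (g : C.inter) {t M : ℝ} (hM : 1 ≤ M) (ht : 1 ≤ M * t) :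
    ‖g‖ ≤ M * C.J g t := by
  have h0 : ‖g.1.1‖ ≤ C.J g t := le_max_left _ _
  have h1 : t * ‖g.1.2‖ ≤ C.J g t := le_max_right _ _
  have hJ := C.J_nonneg g t
  refine max_le (h0.trans (le_mul_of_one_le_left hJ hM)) ?_
  calc ‖g.1.2‖ ≤ (M * t) * ‖g.1.2‖ := le_mul_of_one_le_left (norm_nonneg _) ht
    _ = M * (t * ‖g.1.2‖) := by ring
    _ ≤ M * C.J g t := by gcongr

theorem J_le_mul_norm (g : C.inter) {t M : ℝ} (hM : 1 ≤ M) (ht : t ≤ M) :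
    C.J g t ≤ M * ‖g‖ := by
  have h0 : ‖g.1.1‖ ≤ ‖g‖ := le_max_left _ _
  have h1 : ‖g.1.2‖ ≤ ‖g‖ := le_max_right _ _
  refine max_le (by nlinarith [norm_nonneg g]) ?_
  exact mul_le_mul ht h1 (norm_nonneg _) (by linarith)

/-! ### The weighted integrand and truncated representations. -/

/-- The weight `t⁻¹ v(t) J(u(t), t)` whose integral is the functional `‖·‖_{0,1,v;J}`. -/
noncomputable def jIntegrand (v : ℝ → ℝ) (u : ℝ → C.inter) (t : ℝ) : ℝ :=
  t ^ (-(0 : ℝ) - 1 / (1 : ℝ≥0∞).toReal) * v t * C.J (u t) t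

theorem jIntegrand_eq (v : ℝ → ℝ) (u : ℝ → C.inter) (t : ℝ) :
    C.jIntegrand v u t = t⁻¹ * v t * C.J (u t) t := by
  simp [jIntegrand, Real.rpow_neg_one]

/-- Since `J(0, t) = 0`, cutting off `u` cuts off the integrand; this turns the error into a tail
integral. -/
theorem jIntegrand_indicator (v : ℝ → ℝ) (u : ℝ → C.inter) (S : Set ℝ) :
    C.jIntegrand v (S.indicator u) = S.indicator (C.jIntegrand v u) := by
  funext t
  by_cases ht : t ∈ S
  · simp [jIntegrand_eq, ht]
  · simp [jIntegrand_eq, ht, J_zero]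

theorem aestronglyMeasurable_jIntegrand {v : ℝ → ℝ} {u : ℝ → C.inter}
    (hv : AEMeasurable v (volume.restrict (Ioi 0)))
    (hu : AEStronglyMeasurable u (volume.restrict (Ioi 0))) :
    AEStronglyMeasurable (C.jIntegrand v u) (volume.restrict (Ioi 0)) := by
  have h0 : AEStronglyMeasurable (fun t => ‖(u t).1.1‖) (volume.restrict (Ioi 0)) :=
    (continuous_fst.comp continuous_subtype_val).norm.comp_aestronglyMeasurable hu
  have h1 : AEStronglyMeasurable (fun t => ‖(u t).1.2‖) (volume.restrict (Ioi 0)) :=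
    (continuous_snd.comp continuous_subtype_val).norm.comp_aestronglyMeasurable hu
  have h2 : AEStronglyMeasurable (fun t : ℝ => t⁻¹) (volume.restrict (Ioi 0)) :=
    measurable_inv.aestronglyMeasurable
  rw [funext (C.jIntegrand_eq v u)]
  exact (h2.mul hv.aestronglyMeasurable).mul
    (h0.sup (measurable_id.aestronglyMeasurable.mul h1))

theorem jNorm_le {v : ℝ → ℝ} {u : ℝ → C.inter} {f : C.Sum} (h : C.IsJRepresentation u f) :
    C.jNorm 0 1 v f ≤ eLpNorm (C.jIntegrand v u) 1 (volume.restrict (Ioi 0)) :=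
  iInf₂_le u h

theorem exists_representation {v : ℝ → ℝ} {f : C.Sum} (hf : f ∈ C.jSpace 0 1 v) :
    ∃ u, C.IsJRepresentation u f ∧
      eLpNorm (C.jIntegrand v u) 1 (volume.restrict (Ioi 0)) < ∞ := by
  have h : C.jNorm 0 1 v f < ∞ := hf
  simp only [jNorm, iInf_lt_iff] at h
  obtain ⟨u, hu, h⟩ := h
  exact ⟨u, hu, h⟩

/-- A representation, integrated over a measurable set on which it is integrable with values in
`X₀ ∩ X₁`, gives an element of `X₀ ∩ X₁`; the rest of the representation represents the
difference. -/
theorem IsJRepresentation.sub_integral {u : ℝ → C.inter} {f : C.Sum}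
    (h : C.IsJRepresentation u f) {S : Set ℝ} (hS : MeasurableSet S) (hS0 : S ⊆ Ioi 0)
    (hi : IntegrableOn (fun s : ℝ => s⁻¹ • u s) S) :
    C.IsJRepresentation (Sᶜ.indicator u) (f - C.interToSum (∫ s in S, s⁻¹ • u s)) := by
  have hind : (fun s : ℝ => s⁻¹ • C.interToSum (Sᶜ.indicator u s))
      = Sᶜ.indicator fun s : ℝ => s⁻¹ • C.interToSum (u s) := by
    funext s
    by_cases hs : s ∈ S <;> simp [hs]
  refine ⟨h.aestronglyMeasurable.indicator hS.compl, ?_, ?_⟩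
  · rw [hind]
    exact h.integrableOn.indicator hS.compl
  -- The integral over `S` is taken in `X₀ ∩ X₁`; the bounded inclusion carries it to the integral
  -- in `X₀ + X₁`.
  · have hS' : C.interToSum (∫ s in S, s⁻¹ • u s) = ∫ s in S, s⁻¹ • C.interToSum (u s) := by
      rw [← interToSumCLM_apply, ← C.interToSumCLM.integral_comp_comm hi]
      simp only [map_smul, interToSumCLM_apply]
    have hadd := integral_add_compl hS h.integrableOn
    rw [Measure.restrict_restrict hS, inter_eq_left.2 hS0, h.integral_eq] at hadd
    rw [hind, integral_indicator hS.compl, hS', ← hadd, add_sub_cancel_left]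

/-- The function equal to `g` on `(1, e]` and `0` elsewhere represents `g`, because `ds/s` gives
this interval mass one. Its weighted integrand is bounded by a constant on a set of finite measure.
-/
theorem interToSum_mem_jSpace {v : ℝ → ℝ} (hpos : ∀ t, 0 < t → 0 < v t)
    (hanti : AntitoneOn v (Ioi 0)) (g : C.inter) : C.interToSum g ∈ C.jSpace 0 1 v := by
  set S : Set ℝ := Ioc 1 (Real.exp 1)
  have he : 1 ≤ Real.exp 1 := Real.one_le_exp zero_le_one
  have hSsub : S ⊆ Ioi 0 := fun t ht => zero_lt_one.trans ht.1
  have hS : MeasurableSet S := measurableSet_Ioc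
  have hind : (fun s : ℝ => s⁻¹ • C.interToSum (S.indicator (fun _ => g) s))
      = S.indicator fun s : ℝ => s⁻¹ • C.interToSum g := by
    funext s
    by_cases hs : s ∈ S <;> simp [hs]
  have hinv : IntegrableOn (fun s : ℝ => s⁻¹) S :=
    (intervalIntegrable_iff_integrableOn_Ioc_of_le he).1
      (intervalIntegral.intervalIntegrable_inv (fun x hx => by
        rw [uIcc_of_le he] at hx; linarith [hx.1]) continuousOn_id)
  have hone : ∫ s in S, s⁻¹ = 1 := by
    rw [← intervalIntegral.integral_of_le he, integral_inv_of_pos one_pos (Real.exp_pos 1)]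
    simp
  have hrep : C.IsJRepresentation (S.indicator fun _ => g) (C.interToSum g) := by
    refine ⟨aestronglyMeasurable_const.indicator hS, ?_, ?_⟩
    · rw [hind]
      have hsmul : IntegrableOn (fun s : ℝ => s⁻¹ • C.interToSum g) S :=
        hinv.smul_const (C.interToSum g)
      exact (integrableOn_indicator_iff hS).2 (hsmul.mono_set inter_subset_left)
    · rw [hind, setIntegral_indicator hS, inter_eq_right.2 hSsub, integral_smul_const, hone,
        one_smul]
  refine (C.jNorm_le hrep).trans_lt ?_
  have hb : ∀ t, ‖C.jIntegrand v (S.indicator fun _ => g) t‖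
      ≤ ‖S.indicator (fun _ => v 1 * (Real.exp 1 * ‖g‖)) t‖ := by
    intro t
    rw [jIntegrand_indicator]
    by_cases ht : t ∈ S
    · have ht0 : 0 < t := hSsub ht
      have hJ := C.J_nonneg g t
      have hv := hpos t ht0
      rw [indicator_of_mem ht, indicator_of_mem ht, jIntegrand_eq]
      refine (Real.norm_of_nonneg (by positivity)).trans_le (le_trans ?_ (le_abs_self _))
      have h1 : t⁻¹ ≤ 1 := inv_le_one_of_one_le₀ ht.1.le
      have h2 : v t ≤ v 1 := hanti (mem_Ioi.2 one_pos) (mem_Ioi.2 ht0) ht.1.le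
      calc t⁻¹ * v t * C.J g t ≤ 1 * v 1 * (Real.exp 1 * ‖g‖) := by
            gcongr
            · exact mul_nonneg zero_le_one (hpos 1 one_pos).le
            · exact C.J_le_mul_norm g he ht.2
        _ = _ := by rw [one_mul]
    · simp [ht]
  refine (eLpNorm_mono hb).trans_lt ?_
  refine (memLp_indicator_const 1 hS _ (Or.inr ?_)).eLpNorm_lt_top
  exact ((Measure.restrict_apply_le _ _).trans_lt measure_Ioc_lt_top).ne

/-- For `t ≥ 1/M` the norm of `u(t)/t` is at most `M / l` times the weighted integrand: `M` pays for
replacing the norm by `J`, and `1 / l` for inserting the weight. -/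
theorem integrableOn_of_jIntegrand {v : ℝ → ℝ} {u : ℝ → C.inter} {l : ℝ} (hl : 0 < l)
    (hv : ∀ t, 0 < t → l ≤ v t) (hu : AEStronglyMeasurable u (volume.restrict (Ioi 0)))
    (hint : IntegrableOn (C.jIntegrand v u) (Ioi 0)) {M : ℝ} (hM : 1 ≤ M) :
    IntegrableOn (fun s : ℝ => s⁻¹ • u s) (Icc M⁻¹ M) := by
  have hM0 : 0 < M := by linarith
  have hsub : Icc M⁻¹ M ⊆ Ioi 0 := fun t ht => (inv_pos.2 hM0).trans_le ht.1
  refine ((hint.mono_set hsub).const_mul (M / l)).mono'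
    (measurable_inv.aestronglyMeasurable.smul (hu.mono_measure (Measure.restrict_mono hsub le_rfl)))
    ?_
  refine (ae_restrict_iff' measurableSet_Icc).2 (ae_of_all _ fun t ht => ?_)
  have ht0 : 0 < t := hsub ht
  have hJ := C.J_nonneg (u t) t
  have h1 : 1 ≤ M * t := by
    calc 1 = M * M⁻¹ := (mul_inv_cancel₀ hM0.ne').symm
      _ ≤ M * t := by gcongr; exact ht.1
  rw [jIntegrand_eq, norm_smul, norm_inv, Real.norm_of_nonneg ht0.le]
  calc t⁻¹ * ‖u t‖ ≤ t⁻¹ * (M * C.J (u t) t) := by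
        gcongr
        exact C.norm_le_mul_J _ hM h1
    _ = M / l * (t⁻¹ * l * C.J (u t) t) := by field_simp
    _ ≤ M / l * (t⁻¹ * v t * C.J (u t) t) := by
        gcongr
        exact hv t ht0

end CompatibleCouple

/-! ### Vanishing tails and the density theorem. -/

/-- The integral of an integrable function on `(0, ∞)` over the complement of `[1/M, M]` tends
to zero. -/
theorem exists_eLpNorm_indicator_compl_Icc_lt {F : ℝ → ℝ} (hF : IntegrableOn F (Ioi 0))
    {ε : ℝ≥0∞} (hε : 0 < ε) :
    ∃ M : ℝ, 1 ≤ M ∧ eLpNorm ((Icc M⁻¹ M)ᶜ.indicator F) 1 (volume.restrict (Ioi 0)) < ε := by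
  have hlim : Tendsto (fun n : ℕ => ∫⁻ t in Ioi (0 : ℝ),
      ‖(Icc ((n : ℝ) + 1)⁻¹ ((n : ℝ) + 1))ᶜ.indicator F t‖ₑ) atTop
      (𝓝 (∫⁻ _ in Ioi (0 : ℝ), 0)) := by
    refine tendsto_lintegral_of_dominated_convergence' (fun t => ‖F t‖ₑ) (fun n => ?_)
      (fun n => ae_of_all _ fun t => enorm_indicator_le_enorm_self _ _) hF.2.ne ?_
    · exact (hF.1.indicator measurableSet_Icc.compl).enorm
    · refine (ae_restrict_iff' measurableSet_Ioi).2 (ae_of_all _ fun t ht => ?_)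
      -- For fixed `t` the truncated function is eventually zero: `t` lies in the interval once `n`
      -- exceeds both `t` and `1/t`.
      refine tendsto_const_nhds.congr' ?_
      obtain ⟨N, hN⟩ := exists_nat_ge (max t t⁻¹)
      filter_upwards [eventually_ge_atTop N] with n hn
      have hnN : (N : ℝ) ≤ n := by exact_mod_cast hn
      have h1 : t ≤ (n : ℝ) + 1 := by linarith [le_max_left t t⁻¹]
      have h2 : t⁻¹ ≤ (n : ℝ) + 1 := by linarith [le_max_right t t⁻¹]
      have hmem : t ∈ Icc ((n : ℝ) + 1)⁻¹ ((n : ℝ) + 1) := ⟨inv_le_of_inv_le₀ ht h2, h1⟩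
      rw [indicator_of_notMem (notMem_compl_iff.2 hmem), enorm_zero]
  rw [lintegral_zero] at hlim
  obtain ⟨n, hn⟩ := (hlim.eventually_lt_const hε).exists
  -- The shift by one guarantees `M ≥ 1` even for `n = 0`.
  refine ⟨n + 1, by simp, ?_⟩
  rwa [eLpNorm_one_eq_lintegral_enorm]

theorem theorem1p19 {𝕜 : Type*} [RCLike 𝕜]
    {X₀ : Type*} [NormedAddCommGroup X₀] [NormedSpace 𝕜 X₀] [CompleteSpace X₀]
    {X₁ : Type*} [NormedAddCommGroup X₁] [NormedSpace 𝕜 X₁] [CompleteSpace X₁]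
    {E : Type*} [AddCommGroup E] [Module 𝕜 E] [TopologicalSpace E]
    [IsTopologicalAddGroup E] [ContinuousSMul 𝕜 E] [T2Space E]
    (C : CompatibleCouple 𝕜 X₀ X₁ E) (a : ℝ → ℝ)
    (ha_sv : SlowlyVarying a) (ha_ac : AbsContOnPos a)
    (ha_anti : StrictAntiOn a (Ioi 0))
    (ha_zero : Tendsto a (𝓝[>] 0) atTop)
    (ha_infty : ∃ l : ℝ, 0 < l ∧ Tendsto a atTop (𝓝 l)) :
    (∀ g : C.inter, C.interToSum g ∈ C.jSpace 0 1 a) ∧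
    ∀ f ∈ C.jSpace 0 1 a, ∀ ε : ℝ≥0∞, 0 < ε →
      ∃ g : C.inter, C.jNorm 0 1 a (f - C.interToSum g) < ε := by
  refine ⟨C.interToSum_mem_jSpace ha_sv.pos ha_anti.antitoneOn, fun f hf ε hε => ?_⟩
  obtain ⟨l, hl, hlim⟩ := ha_infty
  -- A decreasing function lies above its limit at infinity.
  have hal : ∀ t, 0 < t → l ≤ a t := fun t ht =>
    le_of_tendsto hlim <| (eventually_ge_atTop t).mono fun s hs =>
      ha_anti.antitoneOn ht (ht.trans_le hs) hs
  obtain ⟨u, hu, hfin⟩ := C.exists_representation hf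
  have hint : IntegrableOn (C.jIntegrand a u) (Ioi 0) :=
    memLp_one_iff_integrable.1
      ⟨C.aestronglyMeasurable_jIntegrand ha_sv.aemeasurable hu.aestronglyMeasurable, hfin⟩
  obtain ⟨M, hM, hlt⟩ := exists_eLpNorm_indicator_compl_Icc_lt hint hε
  have hsub : Icc M⁻¹ M ⊆ Ioi 0 := fun t ht =>
    (inv_pos.2 (zero_lt_one.trans_le hM)).trans_le ht.1
  refine ⟨∫ s in Icc M⁻¹ M, s⁻¹ • u s, ?_⟩
  refine (C.jNorm_le (hu.sub_integral C measurableSet_Icc hsub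
    (C.integrableOn_of_jIntegrand hl hal hu.aestronglyMeasurable hint hM))).trans_lt ?_
  rwa [C.jIntegrand_indicator]
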